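/- Let $d\ge 1$ be an integer, $m\in(0,1)$, and, for $D>0$, let $$V_D(x)=\Big(D+\frac{1-m}{2m}|x|^2\Big)^{-\frac1{1-m}}\quad(x\in\mathbb{R}^d),\qquad d\mu=V_D^{2-m}\,dx,\qquad d\nu=V_D\,dx .$$ For $d\ge 5$ put $m_*=\frac{d-4}{d-2}$. Let $\mathcal D(\mathbb{R}^d)$ be the space of real-valued smooth compactly supported functions on $\mathbb{R}^d$. (1) If $1\le d\le 4$, or if $d\ge 5$ and $m\in(m_*,1)$, then there is a constant $\mathcal C_{m,d}>0$, depending only on $m$ and $d$ (in particular not on $D$), such that for every $D>0$ the measure $\mu$ is finite and $$\int_{\mathbb{R}^d}|g-\overline g|^2\,d\mu\le\mathcal C_{m,d}\int_{\mathbb{R}^d}|\nabla g|^2\,d\nu\quad\text{for all } g\in\mathcal D(\mathbb{R}^d),\qquad\text{where }\ \overline g=\frac{\int_{\mathbb{R}^d} g\,d\mu}{\int_{\mathbb{R}^d}d\mu}.$$ (2) If $d\ge 5$ and $m\in(0,m_*)$, then for every $D>0$ $$\int_{\mathbb{R}^d}g^2\,d\mu\le\mathcal C_{m,d}\int_{\mathbb{R}^d}|\nabla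 g|^2\,d\nu\quad\text{for all } g\in\mathcal D(\mathbb{R}^d),\qquad \mathcal C_{m,d}=\frac{8\,m\,(1-m)}{[(d-2)(m-m_*)]^2},$$ and for every $D>0$ this constant is optimal, i.e. it is the smallest real number for which the inequality holds for all $g\in\mathcal D(\mathbb{R}^d)$. -/

import Mathlib

open MeasureTheory
open scoped ContDiff

noncomputable section

namespace HardyPoincare

/-- The critical exponent `m_* = (d - 4) / (d - 2)`. -/
def mStar (d : ℕ) : ℝ := ((d : ℝ) - 4) / ((d : ℝ) - 2)

/-- The Barenblatt profile `V_D(x) = (D + (1 - m) / (2 m) |x|²) ^ (-1 / (1 - m))` on `ℝᵈ`. -/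
def barenblatt (d : ℕ) (m D : ℝ) (x : EuclideanSpace ℝ (Fin d)) : ℝ :=
  (D + (1 - m) / (2 * m) * ‖x‖ ^ 2) ^ (-(1 / (1 - m)))

/-- The measure `dμ = V_D ^ (2 - m) dx`. -/
def muMeasure (d : ℕ) (m D : ℝ) : Measure (EuclideanSpace ℝ (Fin d)) :=
  volume.withDensity fun x => ENNReal.ofReal (barenblatt d m D x ^ (2 - m))

/-- The measure `dν = V_D dx`. -/
def nuMeasure (d : ℕ) (m D : ℝ) : Measure (EuclideanSpace ℝ (Fin d)) :=
  volume.withDensity fun x => ENNReal.ofReal (barenblatt d m D x)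

/-- `g` belongs to the space of real-valued smooth compactly supported functions on `ℝᵈ`. -/
def IsTestFunction {d : ℕ} (g : EuclideanSpace ℝ (Fin d) → ℝ) : Prop :=
  ContDiff ℝ ∞ g ∧ HasCompactSupport g

/-- The mean value `(∫ g dμ) / (∫ dμ)` of `g` with respect to `μ`. -/
def weightedMean {d : ℕ} (m D : ℝ) (g : EuclideanSpace ℝ (Fin d) → ℝ) : ℝ :=
  (∫ x, g x ∂(muMeasure d m D)) / (muMeasure d m D).real Set.univ

/-- The weighted Dirichlet energy `∫ |∇g|² dν`. -/
def energy {d : ℕ} (m D : ℝ) (g : EuclideanSpace ℝ (Fin d) → ℝ) : ℝ :=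
  ∫ x, ‖gradient g x‖ ^ 2 ∂(nuMeasure d m D)

end HardyPoincare

end

/-! Put `c = (1 - m) / (2 m)`, `w = D + c |x|²` and `q = 1 + 1 / (1 - m)`, so that `dμ = w ^ (-q)
dx` and `dν = w ^ (1 - q) dx`. For `d ≥ 5` the sign of `d - 2 q` is the sign of `m_* - m`.
Everything rests on the field `X = w ^ (-q) x`, whose divergence is `(d - 2 q + 2 q D / w) w ^ (-q)`
(`divWeight_eq`), and on `|x|² w ^ (-q) ≤ w ^ (1 - q) / c`.

If `2 q < d`, then `div X ≥ (d - 2 q) w ^ (-q)`. Integrating `g² div X` by parts and applying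
Young's inequality gives `hardy_inequality` with constant `4 / (c (d - 2 q)²)`. The powers `w ^
(-s)`, cut off on a logarithmic scale, show that it is sharp as `s` decreases to `(d - 2 q) / 4`
(`le_of_forall_hardy`).

If `2 q > d`, then `div X` is negative at infinity and has zero integral, so the same argument
applies to `g - a` for any constant `a`. It leaves an error on a ball with `R²` proportional to `D`
(`half_mul_integral_sq_sub_le`). There the weights are comparable to constants, and the Poincaré
inequality on the ball bounds the error for a suitable `a`; the powers of `D` cancel
(`exists_poincare_constant`). The `μ`-mean does at least as well as this `a`. -/

noncomputable section

namespace HardyPoincare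

open Set Filter Topology Module

set_option linter.unusedSectionVars false

/-! ### The quadratic weight and the divergence of the radial field -/

section Weight

variable {E : Type*} [NormedAddCommGroup E] [InnerProductSpace ℝ E]

/-- The quadratic weight `D + c |x|²`. -/
def weight (c D : ℝ) (x : E) : ℝ := D + c * ‖x‖ ^ 2

variable {c D : ℝ}

theorem weight_pos (hc : 0 < c) (hD : 0 < D) (x : E) : 0 < weight c D x := by
  unfold weight; positivity

theorem le_weight (hc : 0 < c) (x : E) : D ≤ weight c D x := by
  unfold weight
  have : 0 ≤ c * ‖x‖ ^ 2 := by positivity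
  linarith

theorem mul_norm_sq_eq (x : E) : c * ‖x‖ ^ 2 = weight c D x - D := by
  unfold weight; ring

theorem hasFDerivAt_weight (x : E) :
    HasFDerivAt (weight c D) ((2 * c) • innerSL ℝ x) x := by
  have := ((hasStrictFDerivAt_norm_sq x).hasFDerivAt.const_mul c).const_add D
  refine this.congr_fderiv ?_
  ext v
  simp
  ring

theorem contDiff_weight {n : WithTop ℕ∞} : ContDiff ℝ n (weight c D : E → ℝ) := by
  unfold weight
  exact contDiff_const.add (contDiff_const.mul (contDiff_norm_sq ℝ))

theorem contDiff_weight_rpow (hc : 0 < c) (hD : 0 < D) (s : ℝ) {n : WithTop ℕ∞} :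
    ContDiff ℝ n (fun x : E => weight c D x ^ s) :=
  contDiff_weight.rpow_const_of_ne fun x => (weight_pos hc hD x).ne'

theorem hasFDerivAt_weight_rpow (hc : 0 < c) (hD : 0 < D) (s : ℝ) (x : E) :
    HasFDerivAt (fun x : E => weight c D x ^ s)
      ((s * weight c D x ^ (s - 1) * (2 * c)) • innerSL ℝ x) x := by
  have := (hasFDerivAt_weight (c := c) (D := D) x).rpow_const (p := s)
    (Or.inl (weight_pos hc hD x).ne')
  rwa [smul_smul] at this

theorem norm_sq_mul_weight_rpow_le (hc : 0 < c) (hD : 0 < D) (q : ℝ) (x : E) :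
    ‖x‖ ^ 2 * weight c D x ^ (-q) ≤ 1 / c * weight c D x ^ (1 - q) := by
  have hw := weight_pos hc hD x
  have h1 : weight c D x ^ (1 - q) = weight c D x * weight c D x ^ (-q) := by
    rw [sub_eq_add_neg, Real.rpow_add hw, Real.rpow_one]
  rw [h1, ← mul_assoc]
  gcongr
  rw [one_div, inv_mul_eq_div, le_div_iff₀ hc]
  unfold weight
  linarith

variable [FiniteDimensional ℝ E] [MeasurableSpace E] [BorelSpace E]

theorem integrable_weight_rpow (hc : 0 < c) (hD : 0 < D) {q : ℝ} (hq : (finrank ℝ E : ℝ) < 2 * q) :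
    Integrable (fun x : E => weight c D x ^ (-q)) := by
  have hq0 : 0 < q := by
    have : (0 : ℝ) ≤ finrank ℝ E := Nat.cast_nonneg _
    linarith
  have h := (integrable_rpow_neg_one_add_norm_sq (μ := (volume : Measure E)) hq).const_mul
    (min D c ^ (-q))
  refine h.mono' (contDiff_weight_rpow hc hD _ (n := 0)).continuous.aestronglyMeasurable
    (Eventually.of_forall fun x => ?_)
  have hw := weight_pos hc hD x
  have hm : 0 < min D c := lt_min hD hc
  rw [Real.norm_of_nonneg (by positivity), show -(2 * q) / 2 = -q by ring,
    ← Real.mul_rpow hm.le (by positivity)]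
  refine Real.rpow_le_rpow_of_nonpos (by positivity) ?_ (by linarith)
  unfold weight
  nlinarith [min_le_left D c, min_le_right D c, sq_nonneg ‖x‖]

/-- The divergence theorem for the vector field `h(x) x`. -/
theorem integral_finrank_mul_add_fderiv_self {h : E → ℝ} (hh : ContDiff ℝ 1 h)
    (hs : HasCompactSupport h) :
    ∫ x, ((finrank ℝ E : ℝ) * h x + fderiv ℝ h x x) = 0 := by
  set b := stdOrthonormalBasis ℝ E
  have hc := hh.continuous
  have hc' : Continuous (fderiv ℝ h) := hh.continuous_fderiv one_ne_zero
  have hs' : HasCompactSupport (fderiv ℝ h) := hs.fderiv ℝ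
  have hcs : ∀ i, HasCompactSupport fun x => inner ℝ (b i) x * fderiv ℝ h x (b i) := fun i =>
    hs'.mono fun x hx => by
      contrapose! hx
      simp only [Function.mem_support, not_not] at hx ⊢
      simp [hx]
  have hint : ∀ i, Integrable fun x => inner ℝ (b i) x * fderiv ℝ h x (b i) := fun i =>
    Continuous.integrable_of_hasCompactSupport (by fun_prop) (hcs i)
  have hhint : Integrable h := hc.integrable_of_hasCompactSupport hs
  have hexp : ∀ x, fderiv ℝ h x x = ∑ i, inner ℝ (b i) x * fderiv ℝ h x (b i) := by
    intro x
    conv_lhs =>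
      arg 2
      rw [← b.sum_repr' x]
    simp [map_sum]
  -- Integration by parts in the direction `b i` against the linear coordinate `⟨b i, x⟩`, whose
  -- derivative is 1.
  have hone : ∀ i, ∫ x, inner ℝ (b i) x * fderiv ℝ h x (b i) = - ∫ x, h x := by
    intro i
    have hfd : ∀ x, fderiv ℝ (fun x : E => inner ℝ (b i) x) x (b i) = 1 := by
      intro x
      have : (fun x : E => inner ℝ (b i) x) = innerSL ℝ (b i) := rfl
      rw [this, ContinuousLinearMap.fderiv]
      simp
    have := integral_mul_fderiv_eq_neg_fderiv_mul_of_integrable (μ := (volume : Measure E))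
      (f := fun x => inner ℝ (b i) x) (g := h) (v := b i)
      (by simpa [hfd] using hhint) (hint i)
      (Continuous.integrable_of_hasCompactSupport (by fun_prop) hs.mul_left)
      (fun x _ => (innerSL ℝ (b i)).differentiableAt)
      (fun x _ => hh.differentiable one_ne_zero x)
    rw [this]
    simp [hfd]
  simp_rw [hexp]
  rw [integral_add (hhint.const_mul _) (integrable_finsetSum _ fun i _ => hint i),
    integral_const_mul, integral_finsetSum _ fun i _ => hint i]
  simp [hone]

/-- The divergence of the vector field `x ↦ (D + c |x|²) ^ (-q) x`. -/
def divWeight (c D q : ℝ) (x : E) : ℝ :=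
  finrank ℝ E * weight c D x ^ (-q) - 2 * q * c * ‖x‖ ^ 2 * weight c D x ^ (-q - 1)

/-- Substituting `c |x|² = w - D` separates the limiting coefficient `d - 2 q`, whose sign decides
between Hardy and Poincaré, from a nonnegative correction (for `q ≥ 0`) that decays at infinity. -/
theorem divWeight_eq (hc : 0 < c) (hD : 0 < D) (q : ℝ) (x : E) :
    divWeight c D q x =
      (finrank ℝ E - 2 * q + 2 * q * (D / weight c D x)) * weight c D x ^ (-q) := by
  have hw := weight_pos hc hD x
  have h1 : weight c D x ^ (-q - 1) = weight c D x ^ (-q) / weight c D x :=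
    Real.rpow_sub_one hw.ne' _
  have h2 := mul_norm_sq_eq (c := c) (D := D) x
  unfold divWeight
  rw [h1, show 2 * q * c * ‖x‖ ^ 2 = 2 * q * (c * ‖x‖ ^ 2) by ring, h2]
  field_simp
  ring

theorem continuous_divWeight (hc : 0 < c) (hD : 0 < D) (q : ℝ) :
    Continuous (divWeight c D q : E → ℝ) := by
  have h1 := (contDiff_weight_rpow (E := E) hc hD (-q) (n := 0)).continuous
  have h2 := (contDiff_weight_rpow (E := E) hc hD (-q - 1) (n := 0)).continuous
  unfold divWeight
  fun_prop

theorem integrable_divWeight (hc : 0 < c) (hD : 0 < D) {q : ℝ}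
    (hq : (finrank ℝ E : ℝ) < 2 * q) : Integrable (divWeight c D q : E → ℝ) := by
  refine ((integrable_weight_rpow hc hD hq).const_mul (4 * q)).mono'
    (continuous_divWeight hc hD q).aestronglyMeasurable (Eventually.of_forall fun x => ?_)
  have hd : (0 : ℝ) ≤ finrank ℝ E := Nat.cast_nonneg _
  have hw := weight_pos hc hD x
  have h1 : D / weight c D x ≤ 1 := (div_le_one hw).2 (le_weight hc x)
  have h2 : 0 ≤ D / weight c D x := by positivity
  rw [divWeight_eq hc hD, norm_mul, Real.norm_of_nonneg (by positivity : 0 ≤ weight c D x ^ (-q))]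
  gcongr
  rw [Real.norm_eq_abs, abs_le]
  constructor <;> nlinarith

theorem tendsto_pow_mul_weight_rpow (hc : 0 < c) (hD : 0 < D) {q : ℝ} {n : ℕ} (hq0 : 0 ≤ q)
    (hq : (n : ℝ) < 2 * q) :
    Tendsto (fun r : ℝ => r ^ n * (D + c * r ^ 2) ^ (-q)) atTop (𝓝 0) := by
  have h := (tendsto_rpow_neg_atTop (sub_pos.2 hq)).const_mul (c ^ (-q))
  rw [mul_zero] at h
  refine squeeze_zero' ?_ ?_ h
  · filter_upwards [eventually_gt_atTop 0] with r hr
    positivity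
  · filter_upwards [eventually_gt_atTop 0] with r hr
    have h1 : (D + c * r ^ 2) ^ (-q) ≤ (c * r ^ 2) ^ (-q) :=
      Real.rpow_le_rpow_of_nonpos (by positivity) (by linarith) (by linarith)
    have h2 : (c * r ^ 2) ^ (-q) = c ^ (-q) * r ^ (-(2 * q)) := by
      rw [Real.mul_rpow hc.le (by positivity), ← Real.rpow_natCast r 2, ← Real.rpow_mul hr.le]
      congr 2
      push_cast; ring
    calc r ^ n * (D + c * r ^ 2) ^ (-q) ≤ r ^ n * (c ^ (-q) * r ^ (-(2 * q))) := by
          rw [← h2]; gcongr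
      _ = c ^ (-q) * r ^ (-(2 * q - n)) := by
          rw [show -(2 * q - n) = n + -(2 * q) by ring, Real.rpow_add hr, Real.rpow_natCast]
          ring

/-- In polar coordinates the integrand is the derivative of `r ^ d (D + c r²) ^ (-q)`, which
vanishes at 0 because `d > 0` and at infinity because `2 q > d`. This is what allows constants to be
subtracted from test functions. -/
theorem integral_divWeight [Nontrivial E] (hc : 0 < c) (hD : 0 < D) {q : ℝ}
    (hq : (finrank ℝ E : ℝ) < 2 * q) : ∫ x : E, divWeight c D q x = 0 := by
  have hd : 0 < finrank ℝ E := finrank_pos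
  have hd' : (0 : ℝ) < finrank ℝ E := by exact_mod_cast hd
  set f : ℝ → ℝ := fun r => finrank ℝ E * (D + c * r ^ 2) ^ (-q) -
    2 * q * c * r ^ 2 * (D + c * r ^ 2) ^ (-q - 1) with hf
  have hdf : (divWeight c D q : E → ℝ) = fun x => f ‖x‖ := by
    ext x
    simp [hf, divWeight, weight]
  have hint := integrable_divWeight (E := E) hc hD hq
  rw [hdf, integrable_fun_norm_addHaar] at hint
  rw [hdf, integral_fun_norm_addHaar]
  have hderiv : ∀ r ∈ Ici (0 : ℝ), HasDerivAt (fun r : ℝ => r ^ finrank ℝ E * (D + c * r ^ 2) ^ (-q))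
      (r ^ (finrank ℝ E - 1) • f r) r := by
    intro r hr
    have hw : 0 < D + c * r ^ 2 := by positivity
    have h1 : HasDerivAt (fun r : ℝ => D + c * r ^ 2) (c * (2 * r)) r := by
      simpa using ((hasDerivAt_pow 2 r).const_mul c).const_add D
    have h2 := (hasDerivAt_pow (finrank ℝ E) r).mul (h1.rpow_const (p := -q) (Or.inl hw.ne'))
    refine h2.congr_deriv ?_
    obtain ⟨n, hn⟩ : ∃ n, finrank ℝ E = n + 1 := ⟨_, (Nat.succ_pred_eq_of_pos hd).symm⟩
    simp only [hf, hn, Nat.add_sub_cancel, smul_eq_mul]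
    ring
  rw [integral_Ioi_of_hasDerivAt_of_tendsto' hderiv hint
    (tendsto_pow_mul_weight_rpow hc hD (by linarith) hq)]
  simp [hd.ne']

theorem integral_mul_divWeight_add (hc : 0 < c) (hD : 0 < D) (q : ℝ) {φ : E → ℝ}
    (hφ : ContDiff ℝ 1 φ) (hs : HasCompactSupport φ) :
    ∫ x, (φ x * divWeight c D q x + fderiv ℝ φ x x * weight c D x ^ (-q)) = 0 := by
  rw [← integral_finrank_mul_add_fderiv_self
    (hφ.mul (contDiff_weight_rpow hc hD (-q))) hs.mul_right]
  congr 1 with x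
  have h := (hφ.differentiable one_ne_zero x).hasFDerivAt.mul (hasFDerivAt_weight_rpow hc hD (-q) x)
  rw [show (fun x => φ x * weight c D x ^ (-q)) = φ * fun x => weight c D x ^ (-q) from rfl,
    h.fderiv]
  simp only [divWeight, add_apply, smul_apply,
    innerSL_apply_apply, real_inner_self_eq_norm_sq, smul_eq_mul]
  ring

end Weight

/-! ### Poincaré inequality on a ball -/

section BallPoincare

variable {E : Type*} [NormedAddCommGroup E] [InnerProductSpace ℝ E] [FiniteDimensional ℝ E]
  [MeasurableSpace E] [BorelSpace E]

theorem lintegral_comp_add_smul_le {F : E → ENNReal} (hF : Measurable F) (a : E) {t : ℝ}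
    (ht : 1 / 2 ≤ t) :
    ∫⁻ y, F (a + t • y) ≤ 2 ^ finrank ℝ E * ∫⁻ y, F y := by
  have ht0 : 0 < t := by linarith
  have h1 : ∫⁻ y, F (a + t • y) = ∫⁻ z, F (a + z) ∂(Measure.map (t • ·) volume) := by
    rw [lintegral_map (by fun_prop) (by fun_prop)]
  rw [h1, Measure.map_addHaar_smul _ ht0.ne', lintegral_smul_measure,
    lintegral_add_left_eq_self, smul_eq_mul]
  gcongr
  have : |(t ^ finrank ℝ E)⁻¹| ≤ 2 ^ finrank ℝ E := by
    rw [abs_of_pos (by positivity), ← inv_pow]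
    gcongr
    rw [inv_le_comm₀ ht0 (by norm_num)]
    linarith
  calc ENNReal.ofReal |(t ^ finrank ℝ E)⁻¹| ≤ ENNReal.ofReal (2 ^ finrank ℝ E) :=
        ENNReal.ofReal_le_ofReal this
    _ = 2 ^ finrank ℝ E := by
        rw [ENNReal.ofReal_pow (by norm_num)]
        norm_num

/-- One of `t` and `1 - t` is at least `1 / 2`. Integrating first in the variable carrying that
coefficient keeps the Jacobian below `2 ^ d`, uniformly in `t`. -/
theorem setLIntegral_segment_le {F : E → ENNReal} (hF : Measurable F) (B : Set E)
    (t : ℝ) :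
    ∫⁻ x in B, ∫⁻ y in B, F ((1 - t) • x + t • y) ≤
      2 ^ finrank ℝ E * volume B * ∫⁻ y, F y := by
  have key : ∀ s : ℝ, 1 / 2 ≤ s → ∫⁻ x in B, ∫⁻ y in B, F ((1 - s) • x + s • y) ≤
      2 ^ finrank ℝ E * volume B * ∫⁻ y, F y := by
    intro s hs
    calc ∫⁻ x in B, ∫⁻ y in B, F ((1 - s) • x + s • y)
        ≤ ∫⁻ x in B, 2 ^ finrank ℝ E * ∫⁻ y, F y := by
          refine lintegral_mono fun x => ?_
          exact (setLIntegral_le_lintegral _ _).trans (lintegral_comp_add_smul_le hF _ hs)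
      _ = 2 ^ finrank ℝ E * volume B * ∫⁻ y, F y := by
          rw [setLIntegral_const]; ring
  rcases le_total (1 / 2) t with h | h
  · exact key t h
  · rw [lintegral_lintegral_swap (by fun_prop)]
    convert key (1 - t) (by linarith) using 5 with x y
    rw [sub_sub_cancel, add_comm]

theorem sq_intervalIntegral_le {u : ℝ → ℝ} (hu : Continuous u) :
    (∫ t in (0 : ℝ)..1, u t) ^ 2 ≤ ∫ t in (0 : ℝ)..1, u t ^ 2 := by
  set A := ∫ t in (0 : ℝ)..1, u t with hA
  have h : 0 ≤ ∫ t in (0 : ℝ)..1, (u t - A) ^ 2 :=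
    intervalIntegral.integral_nonneg zero_le_one fun t _ => sq_nonneg _
  have h2 : ∫ t in (0 : ℝ)..1, (u t - A) ^ 2 =
      (∫ t in (0 : ℝ)..1, u t ^ 2) - 2 * A * A + A ^ 2 := by
    have : ∀ t, (u t - A) ^ 2 = u t ^ 2 - 2 * A * u t + A ^ 2 := fun t => by ring
    simp_rw [this]
    have i1 : IntervalIntegrable (fun t => u t ^ 2) volume 0 1 :=
      Continuous.intervalIntegrable (by fun_prop) _ _
    have i2 : IntervalIntegrable (fun t => 2 * A * u t) volume 0 1 :=
      Continuous.intervalIntegrable (by fun_prop) _ _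
    rw [intervalIntegral.integral_add (i1.sub i2) (by simp),
      intervalIntegral.integral_sub i1 i2, intervalIntegral.integral_const_mul, ← hA]
    simp
  nlinarith

/-- Fundamental theorem of calculus along the segment, then Cauchy–Schwarz in `t`. Extended
nonnegative integrals let the later exchanges of integration go through Tonelli. -/
theorem ofReal_sq_sub_le_lintegral {g : E → ℝ} (hg : ContDiff ℝ 1 g) (x y : E) :
    ENNReal.ofReal ((g y - g x) ^ 2) ≤ ENNReal.ofReal (‖y - x‖ ^ 2) *
      ∫⁻ t in Ioc (0 : ℝ) 1, ENNReal.ofReal (‖fderiv ℝ g ((1 - t) • x + t • y)‖ ^ 2) := by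
  have hc : Continuous (fderiv ℝ g) := hg.continuous_fderiv one_ne_zero
  have hd : ∀ t : ℝ, HasDerivAt (fun t : ℝ => g ((1 - t) • x + t • y))
      (fderiv ℝ g ((1 - t) • x + t • y) (y - x)) t := by
    intro t
    have h1 : HasDerivAt (fun t : ℝ => (1 - t) • x + t • y) (y - x) t := by
      have := (((hasDerivAt_id t).const_sub 1).smul_const x).add ((hasDerivAt_id t).smul_const y)
      exact this.congr_deriv (by module)
    exact ((hg.differentiable one_ne_zero _).hasFDerivAt.comp_hasDerivAt t h1)
  have hftc := intervalIntegral.integral_eq_sub_of_hasDerivAt (a := 0) (b := 1)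
    (fun t _ => hd t) (Continuous.intervalIntegrable (by fun_prop) _ _)
  simp only [sub_self, zero_smul, one_smul, zero_add, sub_zero, add_zero] at hftc
  have h1 := sq_intervalIntegral_le (u := fun t => fderiv ℝ g ((1 - t) • x + t • y) (y - x))
    (by fun_prop)
  rw [hftc] at h1
  have h2 : ∫ t in (0 : ℝ)..1, (fderiv ℝ g ((1 - t) • x + t • y) (y - x)) ^ 2 ≤
      ∫ t in (0 : ℝ)..1, ‖y - x‖ ^ 2 * ‖fderiv ℝ g ((1 - t) • x + t • y)‖ ^ 2 := by
    refine intervalIntegral.integral_mono_on zero_le_one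
      (Continuous.intervalIntegrable (by fun_prop) _ _)
      (Continuous.intervalIntegrable (by fun_prop) _ _) fun t _ => ?_
    rw [← mul_pow, ← sq_abs, mul_comm]
    gcongr
    exact (fderiv ℝ g ((1 - t) • x + t • y)).le_opNorm (y - x)
  have h3 := h1.trans h2
  rw [intervalIntegral.integral_const_mul, intervalIntegral.integral_of_le zero_le_one] at h3
  refine (ENNReal.ofReal_le_ofReal h3).trans ?_
  rw [ENNReal.ofReal_mul (by positivity), ofReal_integral_eq_lintegral_ofReal]
  · exact (Continuous.integrableOn_Icc (by fun_prop)).mono_set Ioc_subset_Icc_self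
  · exact Eventually.of_forall fun t => by positivity

/-- Poincaré inequality on a ball, in double-integral form. -/
theorem lintegral_lintegral_sq_sub_le {g : E → ℝ} (hg : ContDiff ℝ 1 g) (R : ℝ) :
    ∫⁻ x in Metric.ball (0 : E) R, ∫⁻ y in Metric.ball (0 : E) R, ENNReal.ofReal ((g y - g x) ^ 2)
      ≤ ENNReal.ofReal (4 * R ^ 2) * (2 ^ finrank ℝ E * volume (Metric.ball (0 : E) R) *
        ∫⁻ y in Metric.ball (0 : E) R, ENNReal.ofReal (‖fderiv ℝ g y‖ ^ 2)) := by
  set B := Metric.ball (0 : E) R with hB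
  have hc : Continuous (fderiv ℝ g) := hg.continuous_fderiv one_ne_zero
  have hBm : MeasurableSet B := Metric.isOpen_ball.measurableSet
  -- Cutting the gradient off outside the ball loses nothing, since segments stay in the ball by
  -- convexity, and it lets the inner integral be enlarged to the whole space.
  set F : E → ENNReal := B.indicator fun y => ENNReal.ofReal (‖fderiv ℝ g y‖ ^ 2) with hFdef
  have hF : Measurable F := by
    refine Measurable.indicator ?_ hBm
    fun_prop
  have hpt : ∀ x ∈ B, ∀ y ∈ B, ENNReal.ofReal ((g y - g x) ^ 2) ≤
      ENNReal.ofReal (4 * R ^ 2) * ∫⁻ t in Ioc (0 : ℝ) 1, F ((1 - t) • x + t • y) := by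
    intro x hx y hy
    refine (ofReal_sq_sub_le_lintegral hg x y).trans ?_
    gcongr ?_ * ?_
    · refine ENNReal.ofReal_le_ofReal ?_
      have hx' : ‖x‖ < R := by simpa [hB] using hx
      have hy' : ‖y‖ < R := by simpa [hB] using hy
      have : ‖y - x‖ ≤ 2 * R := (norm_sub_le _ _).trans (by linarith)
      calc ‖y - x‖ ^ 2 ≤ (2 * R) ^ 2 := by gcongr
        _ = 4 * R ^ 2 := by ring
    · refine setLIntegral_mono (by fun_prop) fun t ht => ?_
      have : (1 - t) • x + t • y ∈ B :=
        (convex_ball (0 : E) R) hx hy (by linarith [ht.2]) ht.1.le (by ring)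
      rw [hFdef, indicator_of_mem this]
  calc ∫⁻ x in B, ∫⁻ y in B, ENNReal.ofReal ((g y - g x) ^ 2)
      ≤ ∫⁻ x in B, ∫⁻ y in B, ENNReal.ofReal (4 * R ^ 2) *
          ∫⁻ t in Ioc (0 : ℝ) 1, F ((1 - t) • x + t • y) := by
        refine setLIntegral_mono' hBm fun x hx => setLIntegral_mono' hBm fun y hy => hpt x hx y hy
    _ = ENNReal.ofReal (4 * R ^ 2) * ∫⁻ x in B, ∫⁻ y in B,
          ∫⁻ t in Ioc (0 : ℝ) 1, F ((1 - t) • x + t • y) := by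
        rw [← lintegral_const_mul' _ _ ENNReal.ofReal_ne_top]
        refine lintegral_congr fun x => ?_
        rw [← lintegral_const_mul' _ _ ENNReal.ofReal_ne_top]
    _ = ENNReal.ofReal (4 * R ^ 2) * ∫⁻ t in Ioc (0 : ℝ) 1, ∫⁻ x in B, ∫⁻ y in B,
          F ((1 - t) • x + t • y) := by
        congr 1
        have hswap : ∀ x, ∫⁻ y in B, ∫⁻ t in Ioc (0 : ℝ) 1, F ((1 - t) • x + t • y) =
            ∫⁻ t in Ioc (0 : ℝ) 1, ∫⁻ y in B, F ((1 - t) • x + t • y) := fun x =>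
          lintegral_lintegral_swap (by fun_prop)
        simp_rw [hswap]
        rw [lintegral_lintegral_swap]
        · refine Measurable.aemeasurable ?_
          refine Measurable.lintegral_prod_right' (f := fun z : (E × ℝ) × E =>
            F ((1 - z.1.2) • z.1.1 + z.1.2 • z.2)) ?_
          fun_prop
    _ ≤ ENNReal.ofReal (4 * R ^ 2) * ∫⁻ t in Ioc (0 : ℝ) 1,
          2 ^ finrank ℝ E * volume B * ∫⁻ y, F y := by
        gcongr with t
        exact setLIntegral_segment_le hF B t
    _ = _ := by
        rw [setLIntegral_const, hFdef, lintegral_indicator hBm]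
        simp

theorem exists_setIntegral_ball_sq_sub_le {g : E → ℝ} (hg : ContDiff ℝ 1 g) {R : ℝ} (hR : 0 < R) :
    ∃ a : ℝ, ∫ x in Metric.ball (0 : E) R, (g x - a) ^ 2 ≤
      4 * R ^ 2 * 2 ^ finrank ℝ E * ∫ x in Metric.ball (0 : E) R, ‖fderiv ℝ g x‖ ^ 2 := by
  set B := Metric.ball (0 : E) R with hB
  have hc : Continuous (fderiv ℝ g) := hg.continuous_fderiv one_ne_zero
  have hgc := hg.continuous
  have hv0 : volume B ≠ 0 := (Metric.measure_ball_pos volume (0 : E) hR).ne'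
  have hv1 : volume B ≠ ⊤ := measure_ball_lt_top.ne
  have hint : ∀ f : E → ℝ, Continuous f → IntegrableOn f B := fun f hf =>
    (hf.continuousOn.integrableOn_compact (isCompact_closedBall 0 R)).mono_set
      Metric.ball_subset_closedBall
  set K := ∫⁻ y in B, ENNReal.ofReal (‖fderiv ℝ g y‖ ^ 2) with hK
  have hKe : K = ENNReal.ofReal (∫ x in B, ‖fderiv ℝ g x‖ ^ 2) := by
    rw [ofReal_integral_eq_lintegral_ofReal (hint _ (by fun_prop))]
    exact Eventually.of_forall fun t => by positivity
  have hle := lintegral_lintegral_sq_sub_le hg R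
  rw [← hB, ← hK] at hle
  -- The constant is the value of `g` at a point where the inner integral does not exceed its
  -- average; this turns the double integral into a single one.
  obtain ⟨x, hx, hxle⟩ := exists_le_setLAverage (μ := volume) (s := B)
    (f := fun x => ∫⁻ y in B, ENNReal.ofReal ((g y - g x) ^ 2)) hv0 hv1
    (by
      refine Measurable.aemeasurable ?_
      refine Measurable.lintegral_prod_right' (f := fun z : E × E =>
        ENNReal.ofReal ((g z.2 - g z.1) ^ 2)) ?_
      fun_prop)
  refine ⟨g x, ?_⟩
  have h2 : ENNReal.ofReal (∫ y in B, (g y - g x) ^ 2) ≤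
      ENNReal.ofReal (4 * R ^ 2 * 2 ^ finrank ℝ E * ∫ x in B, ‖fderiv ℝ g x‖ ^ 2) := by
    rw [ofReal_integral_eq_lintegral_ofReal (hint _ (by fun_prop))
      (Eventually.of_forall fun t => by positivity)]
    refine hxle.trans ?_
    rw [setLAverage_eq]
    refine ENNReal.div_le_of_le_mul (hle.trans (le_of_eq ?_))
    have h2 : ENNReal.ofReal (2 ^ finrank ℝ E) = 2 ^ finrank ℝ E := by
      rw [ENNReal.ofReal_pow (by norm_num)]
      norm_num
    rw [hKe, mul_assoc (4 * R ^ 2), ENNReal.ofReal_mul (p := 4 * R ^ 2) (by positivity),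
      ENNReal.ofReal_mul (p := 2 ^ finrank ℝ E) (by positivity), h2]
    ring
  rwa [ENNReal.ofReal_le_ofReal_iff] at h2
  have : 0 ≤ ∫ x in B, ‖fderiv ℝ g x‖ ^ 2 := integral_nonneg fun x => by positivity
  positivity

end BallPoincare

/-! ### Weighted Hardy and Poincaré inequalities -/

section Inequalities

variable {E : Type*} [NormedAddCommGroup E] [InnerProductSpace ℝ E] [FiniteDimensional ℝ E]
  [MeasurableSpace E] [BorelSpace E] {c D q : ℝ} {g : E → ℝ}

theorem integrable_mul_weight_rpow (hc : 0 < c) (hD : 0 < D) (s : ℝ) {φ : E → ℝ}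
    (hφ : Continuous φ) (hs : HasCompactSupport φ) :
    Integrable fun x => φ x * weight c D x ^ s :=
  (hφ.mul (contDiff_weight_rpow hc hD s (n := 0)).continuous).integrable_of_hasCompactSupport
    hs.mul_right

theorem integrable_sq_norm_fderiv_mul_weight (hc : 0 < c) (hD : 0 < D) (s : ℝ)
    (hg : ContDiff ℝ 1 g) (hs : HasCompactSupport g) :
    Integrable fun x => ‖fderiv ℝ g x‖ ^ 2 * weight c D x ^ s := by
  have hc' := hg.continuous_fderiv one_ne_zero
  refine integrable_mul_weight_rpow hc hD s (by fun_prop) ?_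
  exact (hs.fderiv ℝ).comp_left (g := fun l => ‖l‖ ^ 2) (by simp)

theorem integrable_sq_sub_mul_weight (hc : 0 < c) (hD : 0 < D)
    (hq : (finrank ℝ E : ℝ) < 2 * q) (hg : Continuous g) (hs : HasCompactSupport g) (a : ℝ) :
    Integrable fun x => (g x - a) ^ 2 * weight c D x ^ (-q) := by
  have h1 := integrable_mul_weight_rpow hc hD (-q) (φ := fun x => g x * (g x - 2 * a))
    (by fun_prop) hs.mul_right
  refine (h1.add ((integrable_weight_rpow hc hD hq).const_mul (a ^ 2))).congr
    (Eventually.of_forall fun x => ?_)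
  simp only [Pi.add_apply]
  ring

theorem integrable_mul_divWeight_add (hc : 0 < c) (hD : 0 < D) (hg : ContDiff ℝ 1 g)
    (hs : HasCompactSupport g) :
    Integrable fun x => g x * divWeight c D q x + fderiv ℝ g x x * weight c D x ^ (-q) := by
  have hc' := hg.continuous_fderiv one_ne_zero
  have hgc := hg.continuous
  refine Integrable.add ?_ (integrable_mul_weight_rpow hc hD _ (by fun_prop) ?_)
  · exact (hgc.mul (continuous_divWeight hc hD q)).integrable_of_hasCompactSupport hs.mul_right
  · refine (hs.fderiv ℝ).mono fun x hx => ?_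
    contrapose! hx
    simp only [Function.mem_support, not_not] at hx ⊢
    simp [hx]

/-- `g (g - 2 a) = (g - a)² - a²` has the same derivative as `(g - a)²` but is compactly supported
when `g` is, so it can be integrated by parts. -/
theorem fderiv_mul_sub_apply (hg : ContDiff ℝ 1 g) (a : ℝ) (x v : E) :
    fderiv ℝ (fun x => g x * (g x - 2 * a)) x v = 2 * (g x - a) * fderiv ℝ g x v := by
  have h := (hg.differentiable one_ne_zero x).hasFDerivAt
  rw [show (fun x => g x * (g x - 2 * a)) = g * fun x => g x - 2 * a from rfl,
    (h.mul (h.sub_const (2 * a))).fderiv]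
  simp only [add_apply, smul_apply, smul_eq_mul]
  ring

/-- Integration by parts against the radial field `x ↦ (D + c |x|²) ^ (-q) x`, for a function
equal to a constant near infinity. -/
theorem integrable_and_integral_sq_sub_mul_divWeight_add [Nontrivial E] (hc : 0 < c) (hD : 0 < D)
    (hg : ContDiff ℝ 1 g) (hs : HasCompactSupport g) (a : ℝ)
    (ha : a = 0 ∨ (finrank ℝ E : ℝ) < 2 * q) :
    Integrable (fun x => (g x - a) ^ 2 * divWeight c D q x +
      2 * (g x - a) * fderiv ℝ g x x * weight c D x ^ (-q)) ∧
    ∫ x, ((g x - a) ^ 2 * divWeight c D q x +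
      2 * (g x - a) * fderiv ℝ g x x * weight c D x ^ (-q)) = 0 := by
  have hφ : ContDiff ℝ 1 fun x => g x * (g x - 2 * a) := by fun_prop
  have hφs : HasCompactSupport fun x => g x * (g x - 2 * a) := hs.mul_right
  have h1 := integral_mul_divWeight_add hc hD q hφ hφs
  have i1 := integrable_mul_divWeight_add (q := q) hc hD hφ hφs
  simp only [fderiv_mul_sub_apply hg] at h1 i1
  have h2 : Integrable (fun x : E => a ^ 2 * divWeight c D q x) ∧
      ∫ x : E, a ^ 2 * divWeight c D q x = 0 := by
    rcases ha with rfl | hq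
    · simp
    · refine ⟨(integrable_divWeight hc hD hq).const_mul _, ?_⟩
      rw [integral_const_mul, integral_divWeight hc hD hq, mul_zero]
  have heq : (fun x => (g x - a) ^ 2 * divWeight c D q x +
      2 * (g x - a) * fderiv ℝ g x x * weight c D x ^ (-q)) = fun x =>
      (g x * (g x - 2 * a) * divWeight c D q x +
        2 * (g x - a) * fderiv ℝ g x x * weight c D x ^ (-q)) + a ^ 2 * divWeight c D q x := by
    ext x; ring
  rw [heq]
  exact ⟨i1.add h2.1, by rw [integral_add i1 h2.1, h1, h2.2, add_zero]⟩

/-- Young's inequality with free parameter `k`, after which the factor `|x|²` is absorbed by raising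
the exponent of the weight by one. -/
theorem abs_two_mul_fderiv_self_le (hc : 0 < c) (hD : 0 < D) (q : ℝ) {k : ℝ} (hk : 0 < k) (t : ℝ)
    (x : E) :
    |2 * t * fderiv ℝ g x x * weight c D x ^ (-q)| ≤ k * (t ^ 2 * weight c D x ^ (-q)) +
      1 / (k * c) * (‖fderiv ℝ g x‖ ^ 2 * weight c D x ^ (1 - q)) := by
  have hw : 0 < weight c D x ^ (-q) := Real.rpow_pos_of_pos (weight_pos hc hD x) _
  have h1 := norm_sq_mul_weight_rpow_le hc hD q x
  have h2 : |fderiv ℝ g x x| ≤ ‖fderiv ℝ g x‖ * ‖x‖ := (fderiv ℝ g x).le_opNorm x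
  set e := ‖fderiv ℝ g x‖
  have h3 : |2 * t * fderiv ℝ g x x| ≤ k * t ^ 2 + 1 / k * (e * ‖x‖) ^ 2 := by
    have h4 : |2 * t * fderiv ℝ g x x| ≤ 2 * |t| * (e * ‖x‖) := by
      rw [abs_mul, abs_mul, abs_two]
      gcongr
    have h5 : 2 * |t| * (e * ‖x‖) ≤ k * t ^ 2 + 1 / k * (e * ‖x‖) ^ 2 := by
      rw [← sq_abs t]
      have : k * |t| ^ 2 + 1 / k * (e * ‖x‖) ^ 2 - 2 * |t| * (e * ‖x‖) =
        (k * |t| - e * ‖x‖) ^ 2 / k := by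
        field_simp
        ring
      have : 0 ≤ (k * |t| - e * ‖x‖) ^ 2 / k := by positivity
      linarith
    linarith
  rw [abs_mul, abs_of_pos hw]
  calc |2 * t * fderiv ℝ g x x| * weight c D x ^ (-q)
      ≤ (k * t ^ 2 + 1 / k * (e * ‖x‖) ^ 2) * weight c D x ^ (-q) := by gcongr
    _ = k * (t ^ 2 * weight c D x ^ (-q)) +
          1 / k * e ^ 2 * (‖x‖ ^ 2 * weight c D x ^ (-q)) := by ring
    _ ≤ k * (t ^ 2 * weight c D x ^ (-q)) +
          1 / k * e ^ 2 * (1 / c * weight c D x ^ (1 - q)) := by gcongr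
    _ = _ := by
        field_simp

/-- The weighted Hardy inequality in the supercritical dimension range `2 q < d`. -/
theorem hardy_inequality [Nontrivial E] (hc : 0 < c) (hD : 0 < D) (hq0 : 0 ≤ q)
    (hq : 2 * q < finrank ℝ E) (hg : ContDiff ℝ 1 g) (hs : HasCompactSupport g) :
    ∫ x, g x ^ 2 * weight c D x ^ (-q) ≤
      4 / (c * (finrank ℝ E - 2 * q) ^ 2) * ∫ x, ‖fderiv ℝ g x‖ ^ 2 * weight c D x ^ (1 - q) := by
  set k : ℝ := finrank ℝ E - 2 * q with hk
  have hk0 : 0 < k := by linarith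
  obtain ⟨hi, h0⟩ := integrable_and_integral_sq_sub_mul_divWeight_add (q := q) hc hD hg hs 0
    (Or.inl rfl)
  simp only [sub_zero] at hi h0
  have hgc := hg.continuous
  have i1 : Integrable fun x => g x ^ 2 * weight c D x ^ (-q) :=
    integrable_mul_weight_rpow hc hD _ (by fun_prop) (hs.comp_left (g := fun t => t ^ 2) (by simp))
  have i2 := integrable_sq_norm_fderiv_mul_weight hc hD (1 - q) hg hs
  have hmono : ∫ x, (k / 2 * (g x ^ 2 * weight c D x ^ (-q)) -
      1 / (k / 2 * c) * (‖fderiv ℝ g x‖ ^ 2 * weight c D x ^ (1 - q))) ≤ 0 := by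
    rw [← h0]
    -- Young's parameter is half of `d - 2 q`, the choice that minimises the resulting constant.
    refine integral_mono ((i1.const_mul _).sub (i2.const_mul _)) hi fun x => ?_
    have h1 := (abs_le.1 (abs_two_mul_fderiv_self_le (g := g) hc hD q (half_pos hk0) (g x) x)).1
    have hw := weight_pos hc hD x
    have h2 : k * (g x ^ 2 * weight c D x ^ (-q)) ≤ g x ^ 2 * divWeight c D q x := by
      rw [divWeight_eq hc hD, ← hk, mul_left_comm]
      gcongr
      have : 0 ≤ 2 * q * (D / weight c D x) := by positivity
      linarith
    linarith
  rw [integral_sub (i1.const_mul _) (i2.const_mul _), integral_const_mul, integral_const_mul]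
    at hmono
  calc ∫ x, g x ^ 2 * weight c D x ^ (-q)
      = 2 / k * (k / 2 * ∫ x, g x ^ 2 * weight c D x ^ (-q)) := by field_simp
    _ ≤ 2 / k * (1 / (k / 2 * c) * ∫ x, ‖fderiv ℝ g x‖ ^ 2 * weight c D x ^ (1 - q)) := by
        gcongr ?_ * ?_
        linarith
    _ = _ := by
        field_simp
        ring

/-- Of the coefficient `k = 2 q - d`, a quarter pays for Young's inequality and a quarter for `2 q D
/ w` outside the ball, where the condition on `R` makes this term at most `k / 4`. Half of `k`
survives, and inside the ball `D / w ≤ 1`. -/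
theorem half_mul_integral_sq_sub_le [Nontrivial E] (hc : 0 < c) (hD : 0 < D)
    (hq : (finrank ℝ E : ℝ) < 2 * q) (hg : ContDiff ℝ 1 g) (hs : HasCompactSupport g) (a : ℝ)
    {R : ℝ} (hR : 8 * q * D ≤ (2 * q - finrank ℝ E) * (c * R ^ 2)) (hR0 : 0 < R) :
    (2 * q - finrank ℝ E) / 2 * ∫ x, (g x - a) ^ 2 * weight c D x ^ (-q) ≤
      4 / ((2 * q - finrank ℝ E) * c) * (∫ x, ‖fderiv ℝ g x‖ ^ 2 * weight c D x ^ (1 - q)) +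
      2 * q * ∫ x in Metric.ball 0 R, (g x - a) ^ 2 * weight c D x ^ (-q) := by
  have hd : (0 : ℝ) ≤ finrank ℝ E := Nat.cast_nonneg _
  set k : ℝ := 2 * q - finrank ℝ E with hk
  have hk0 : 0 < k := by linarith
  have hq0 : 0 < q := by linarith
  obtain ⟨hi, h0⟩ := integrable_and_integral_sq_sub_mul_divWeight_add (q := q) hc hD hg hs a
    (Or.inr hq)
  have i1 := integrable_sq_sub_mul_weight hc hD hq hg.continuous hs a
  have i2 := integrable_sq_norm_fderiv_mul_weight hc hD (1 - q) hg hs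
  have hB : MeasurableSet (Metric.ball (0 : E) R) := Metric.isOpen_ball.measurableSet
  have i3 := i1.indicator hB
  have hmono : 0 ≤ ∫ x, (-(k / 2) * ((g x - a) ^ 2 * weight c D x ^ (-q)) +
      4 / (k * c) * (‖fderiv ℝ g x‖ ^ 2 * weight c D x ^ (1 - q)) + 2 * q *
      (Metric.ball 0 R).indicator (fun x => (g x - a) ^ 2 * weight c D x ^ (-q)) x) := by
    rw [← h0]
    refine integral_mono hi
      (((i1.const_mul _).add (i2.const_mul _)).add (i3.const_mul _)) fun x => ?_
    have h1 := (abs_le.1 (abs_two_mul_fderiv_self_le (g := g) hc hD q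
      (by positivity : 0 < k / 4) (g x - a) x)).2
    have hw := weight_pos hc hD x
    have hY : 0 ≤ (g x - a) ^ 2 * weight c D x ^ (-q) := by positivity
    have h2 : (g x - a) ^ 2 * divWeight c D q x =
        (-k + 2 * q * (D / weight c D x)) * ((g x - a) ^ 2 * weight c D x ^ (-q)) := by
      rw [divWeight_eq hc hD, hk]
      ring
    have h3 : 2 * q * (D / weight c D x) * ((g x - a) ^ 2 * weight c D x ^ (-q)) ≤
        k / 4 * ((g x - a) ^ 2 * weight c D x ^ (-q)) + 2 * q *
        (Metric.ball 0 R).indicator (fun x => (g x - a) ^ 2 * weight c D x ^ (-q)) x := by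
      by_cases hx : x ∈ Metric.ball (0 : E) R
      · rw [indicator_of_mem hx]
        have : D / weight c D x ≤ 1 := (div_le_one hw).2 (le_weight hc x)
        have : 2 * q * (D / weight c D x) ≤ k / 4 + 2 * q := by nlinarith
        nlinarith
      · rw [indicator_of_notMem hx, mul_zero, add_zero]
        gcongr
        rw [mem_ball_zero_iff, not_lt] at hx
        have h4 : c * R ^ 2 ≤ weight c D x := by
          have : c * R ^ 2 ≤ c * ‖x‖ ^ 2 := by gcongr
          unfold weight
          linarith
        rw [← mul_div_assoc, div_le_iff₀ hw]
        have : k * (c * R ^ 2) ≤ k * weight c D x := by gcongr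
        linarith
    have h5 : 1 / (k / 4 * c) = 4 / (k * c) := by field_simp
    rw [h5] at h1
    beta_reduce
    linarith
  have i12 : Integrable fun x => -(k / 2) * ((g x - a) ^ 2 * weight c D x ^ (-q)) +
      4 / (k * c) * (‖fderiv ℝ g x‖ ^ 2 * weight c D x ^ (1 - q)) :=
    (i1.const_mul _).add (i2.const_mul _)
  rw [integral_add i12 (i3.const_mul _),
    integral_add (i1.const_mul _) (i2.const_mul _), integral_const_mul, integral_const_mul,
    integral_const_mul, integral_indicator hB] at hmono
  linarith

/-- On this ball `D ≤ w ≤ (1 + L) D`, so the unweighted inequality transfers at the cost of a power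
of `1 + L`. -/
theorem exists_setIntegral_ball_sq_sub_mul_weight_le (hc : 0 < c) (hD : 0 < D) (hq1 : 1 ≤ q)
    (hg : ContDiff ℝ 1 g) (hs : HasCompactSupport g) {L R : ℝ} (hL : 0 < L) (hR0 : 0 < R)
    (hR : c * R ^ 2 = L * D) :
    ∃ a : ℝ, ∫ x in Metric.ball (0 : E) R, (g x - a) ^ 2 * weight c D x ^ (-q) ≤
      4 * L / c * 2 ^ finrank ℝ E * (1 + L) ^ (q - 1) *
        ∫ x, ‖fderiv ℝ g x‖ ^ 2 * weight c D x ^ (1 - q) := by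
  obtain ⟨a, ha⟩ := exists_setIntegral_ball_sq_sub_le hg hR0
  refine ⟨a, ?_⟩
  set B := Metric.ball (0 : E) R with hB
  have hBm : MeasurableSet B := Metric.isOpen_ball.measurableSet
  have hc' := hg.continuous_fderiv one_ne_zero
  have hgc := hg.continuous
  have hwc : ∀ s : ℝ, Continuous fun x : E => weight c D x ^ s := fun s =>
    (contDiff_weight_rpow hc hD s (n := 0)).continuous
  have hint : ∀ f : E → ℝ, Continuous f → IntegrableOn f B := fun f hf =>
    (hf.continuousOn.integrableOn_compact (isCompact_closedBall 0 R)).mono_set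
      Metric.ball_subset_closedBall
  have i2 := integrable_sq_norm_fderiv_mul_weight hc hD (1 - q) hg hs
  have hWB : ∀ x ∈ B, weight c D x ≤ (1 + L) * D := by
    intro x hx
    rw [hB, mem_ball_zero_iff] at hx
    have : c * ‖x‖ ^ 2 ≤ c * R ^ 2 := by gcongr
    unfold weight
    linarith
  have s1 : ∫ x in B, (g x - a) ^ 2 * weight c D x ^ (-q) ≤ ∫ x in B, D ^ (-q) * (g x - a) ^ 2 := by
    refine setIntegral_mono_on (hint _ (by fun_prop)) (hint _ (by fun_prop)) hBm fun x hx => ?_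
    rw [mul_comm]
    gcongr ?_ * _
    exact Real.rpow_le_rpow_of_nonpos hD (le_weight hc x) (by linarith)
  have s2 : ∫ x in B, ‖fderiv ℝ g x‖ ^ 2 ≤
      ∫ x in B, ((1 + L) * D) ^ (q - 1) * (‖fderiv ℝ g x‖ ^ 2 * weight c D x ^ (1 - q)) := by
    refine setIntegral_mono_on (hint _ (by fun_prop))
      (hint _ (by have := hwc (1 - q); fun_prop)) hBm fun x hx => ?_
    have hw := weight_pos hc hD x
    have h1 : 1 ≤ ((1 + L) * D) ^ (q - 1) * weight c D x ^ (1 - q) := by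
      have : weight c D x ^ (q - 1) * weight c D x ^ (1 - q) = 1 := by
        rw [← Real.rpow_add hw]; simp
      refine this.symm.le.trans ?_
      gcongr
      exact hWB x hx
    have h2 : 0 ≤ ‖fderiv ℝ g x‖ ^ 2 := by positivity
    nlinarith
  have s3 : ∫ x in B, ‖fderiv ℝ g x‖ ^ 2 * weight c D x ^ (1 - q) ≤
      ∫ x, ‖fderiv ℝ g x‖ ^ 2 * weight c D x ^ (1 - q) := by
    refine setIntegral_le_integral i2 (Eventually.of_forall fun x => ?_)
    have hw := weight_pos hc hD x
    exact mul_nonneg (by positivity) (by positivity)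
  rw [integral_const_mul] at s1 s2
  -- Scale invariance: the two weight comparisons and `R² = L D / c` contribute powers of `D` that
  -- cancel exactly.
  have hDq : D ^ (-q) * D * D ^ (q - 1) = 1 := by
    rw [← Real.rpow_add_one hD.ne', ← Real.rpow_add hD]
    ring_nf
    simp
  calc ∫ x in B, (g x - a) ^ 2 * weight c D x ^ (-q)
      ≤ D ^ (-q) * ∫ x in B, (g x - a) ^ 2 := s1
    _ ≤ D ^ (-q) * (4 * R ^ 2 * 2 ^ finrank ℝ E * (((1 + L) * D) ^ (q - 1) *
          ∫ x, ‖fderiv ℝ g x‖ ^ 2 * weight c D x ^ (1 - q))) := by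
        gcongr
        refine ha.trans ?_
        gcongr
        refine s2.trans ?_
        gcongr
    _ = _ := by
        have hR' : R ^ 2 = L * D / c := by
          rw [eq_div_iff hc.ne']; linarith
        rw [hR', Real.mul_rpow (by positivity) hD.le]
        linear_combination (4 * L / c * 2 ^ finrank ℝ E * (1 + L) ^ (q - 1) *
          ∫ x, ‖fderiv ℝ g x‖ ^ 2 * weight c D x ^ (1 - q)) * hDq

/-- The weighted Poincaré inequality, with a constant independent of `D`. -/
theorem exists_poincare_constant (E : Type*) [NormedAddCommGroup E] [InnerProductSpace ℝ E]
    [FiniteDimensional ℝ E] [MeasurableSpace E] [BorelSpace E] [Nontrivial E] {c q : ℝ}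
    (hc : 0 < c) (hq1 : 1 ≤ q) (hq : (finrank ℝ E : ℝ) < 2 * q) :
    ∃ C : ℝ, 0 < C ∧ ∀ D : ℝ, 0 < D → ∀ g : E → ℝ, ContDiff ℝ 1 g → HasCompactSupport g →
      ∃ a : ℝ, ∫ x, (g x - a) ^ 2 * weight c D x ^ (-q) ≤
        C * ∫ x, ‖fderiv ℝ g x‖ ^ 2 * weight c D x ^ (1 - q) := by
  set k : ℝ := 2 * q - finrank ℝ E with hk
  have hk0 : 0 < k := by linarith
  -- The smallest `L` for which `c R² = L D` gives `8 q D ≤ k c R²`.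
  set L : ℝ := 8 * q / k with hL
  have hL0 : 0 < L := by positivity
  set C₁ : ℝ := 4 * L / c * 2 ^ finrank ℝ E * (1 + L) ^ (q - 1) with hC₁
  refine ⟨2 / k * (4 / (k * c) + 2 * q * C₁), by positivity, fun D hD g hg hs => ?_⟩
  have hRsq : c * √(L * D / c) ^ 2 = L * D := by
    rw [Real.sq_sqrt (by positivity)]
    field_simp
  have hR0 : 0 < √(L * D / c) := by positivity
  obtain ⟨a, ha⟩ := exists_setIntegral_ball_sq_sub_mul_weight_le hc hD hq1 hg hs hL0 hR0 hRsq
  refine ⟨a, ?_⟩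
  have h := half_mul_integral_sq_sub_le hc hD hq hg hs a (R := √(L * D / c))
    (by rw [hRsq, hL, ← hk]; field_simp; rfl) hR0
  rw [← hk] at h
  calc ∫ x, (g x - a) ^ 2 * weight c D x ^ (-q)
      = 2 / k * (k / 2 * ∫ x, (g x - a) ^ 2 * weight c D x ^ (-q)) := by field_simp
    _ ≤ 2 / k * (4 / (k * c) * (∫ x, ‖fderiv ℝ g x‖ ^ 2 * weight c D x ^ (1 - q)) +
          2 * q * (C₁ * ∫ x, ‖fderiv ℝ g x‖ ^ 2 * weight c D x ^ (1 - q))) := by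
        gcongr
        refine h.trans ?_
        gcongr
    _ = _ := by ring

end Inequalities

/-! ### Sharpness of the Hardy constant -/

section Optimality

variable {E : Type*} [NormedAddCommGroup E] [InnerProductSpace ℝ E] [FiniteDimensional ℝ E]
  [MeasurableSpace E] [BorelSpace E] {c D q : ℝ}

theorem exists_cutoff :
    ∃ (χ : ℝ → ℝ) (M : ℝ), ContDiff ℝ ∞ χ ∧ (∀ t, 0 ≤ χ t) ∧ (∀ t, χ t ≤ 1) ∧
      (∀ t, |t| ≤ 1 → χ t = 1) ∧ (∀ t, 2 ≤ |t| → χ t = 0) ∧ 0 ≤ M ∧ ∀ t, |deriv χ t| ≤ M := by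
  let b : ContDiffBump (0 : ℝ) := ⟨1, 2, one_pos, one_lt_two⟩
  have hb : ContDiff ℝ ∞ b := b.contDiff
  obtain ⟨M, hM⟩ := (b.hasCompactSupport.deriv).exists_bound_of_continuous
    (hb.continuous_deriv (by simp))
  refine ⟨b, M, hb, fun t => b.nonneg, fun t => b.le_one, fun t ht => ?_, fun t ht => ?_,
    (norm_nonneg _).trans (hM 0), hM⟩
  · exact b.one_of_mem_closedBall (by simpa [b] using ht)
  · exact b.zero_of_le_dist (by simpa [b] using ht)

/-- A power of the weight, cut off on a logarithmic scale. -/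
def cutoffPower (χ : ℝ → ℝ) (c D s N : ℝ) (x : E) : ℝ :=
  weight c D x ^ (-s) * χ (Real.log (weight c D x) / N)

theorem contDiff_cutoffPower (hc : 0 < c) (hD : 0 < D) {χ : ℝ → ℝ} (hχ : ContDiff ℝ ∞ χ)
    (s N : ℝ) : ContDiff ℝ ∞ (cutoffPower χ c D s N : E → ℝ) := by
  refine (contDiff_weight_rpow hc hD _).mul (hχ.comp ?_)
  exact (contDiff_weight.log fun x => (weight_pos hc hD x).ne').div_const N

theorem hasCompactSupport_cutoffPower (hc : 0 < c) (hD : 0 < D) {χ : ℝ → ℝ}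
    (h0 : ∀ t, 2 ≤ |t| → χ t = 0) (s : ℝ) {N : ℝ} (hN : 0 < N) :
    HasCompactSupport (cutoffPower χ c D s N : E → ℝ) := by
  refine HasCompactSupport.intro (isCompact_closedBall (0 : E) √(Real.exp (2 * N) / c))
    fun x hx => ?_
  rw [mem_closedBall_zero_iff, not_le, Real.sqrt_lt' (lt_of_le_of_lt (Real.sqrt_nonneg _)
    (by simpa using hx)), div_lt_iff₀ hc] at hx
  have h1 : 2 * N ≤ Real.log (weight c D x) := by
    rw [Real.le_log_iff_exp_le (weight_pos hc hD x)]
    unfold weight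
    linarith
  unfold cutoffPower
  rw [h0, mul_zero]
  refine le_trans ?_ (le_abs_self _)
  rwa [le_div_iff₀ hN]

/-- Differentiating `log w / N` yields the same factor `1 / w` as differentiating the power, so the
cutoff only changes `s` into `s + M / N`, an error that vanishes as `N` grows. -/
theorem sq_norm_fderiv_cutoffPower_le (hc : 0 < c) (hD : 0 < D) {χ : ℝ → ℝ}
    (hχ : ContDiff ℝ ∞ χ) (h0 : ∀ t, 0 ≤ χ t) (h1 : ∀ t, χ t ≤ 1) {M : ℝ}
    (hM : ∀ t, |deriv χ t| ≤ M) {s N : ℝ} (hs : 0 ≤ s) (hN : 0 < N) (x : E) :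
    ‖fderiv ℝ (cutoffPower χ c D s N) x‖ ^ 2 ≤
      4 * c * (s + M / N) ^ 2 * weight c D x ^ (-(2 * s) - 1) := by
  have hw := weight_pos hc hD x
  set w := weight c D x with hwdef
  have hd : HasFDerivAt (cutoffPower χ c D s N)
      ((w ^ (-s - 1) * (2 * c) * (-s * χ (Real.log w / N) + deriv χ (Real.log w / N) / N)) •
        innerSL ℝ x) x := by
    have d1 := hasFDerivAt_weight_rpow hc hD (-s) x
    have d2 := ((hasFDerivAt_weight (c := c) (D := D) x).log hw.ne').mul_const (1 / N)
    have d3 := ((hχ.differentiable (by simp)) (Real.log w / N)).hasDerivAt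
    rw [div_eq_mul_one_div] at d3
    have d4 := d3.comp_hasFDerivAt x d2
    have d5 := d1.mul d4
    have e : cutoffPower χ c D s N = (fun x : E => weight c D x ^ (-s)) *
        (χ ∘ fun x => Real.log (weight c D x) * (1 / N)) := by
      ext y
      simp [cutoffPower, div_eq_mul_inv]
    rw [e]
    refine d5.congr_fderiv ?_
    have hpow : w ^ (-s) = w ^ (-s - 1) * w := by
      rw [Real.rpow_sub_one hw.ne']; field_simp
    ext v
    simp only [add_apply, smul_apply, smul_eq_mul, Function.comp, ← hwdef, hpow,
      div_eq_mul_one_div (Real.log w) N]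
    field_simp
    ring
  have hr : c * ‖x‖ ^ 2 ≤ w := by
    rw [mul_norm_sq_eq (D := D) x]; linarith
  rw [hd.fderiv, norm_smul, innerSL_apply_norm, mul_pow, Real.norm_eq_abs, sq_abs]
  set y := Real.log w / N
  have hA : (-s * χ y + deriv χ y / N) ^ 2 ≤ (s + M / N) ^ 2 := by
    rw [← sq_abs]
    gcongr
    refine (abs_add_le _ _).trans ?_
    rw [abs_mul, abs_neg, abs_of_nonneg hs, abs_of_nonneg (h0 y), abs_div, abs_of_pos hN]
    gcongr
    · exact mul_le_of_le_one_right hs (h1 y)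
    · exact hM y
  have hpow : (w ^ (-s - 1)) ^ 2 * w = w ^ (-(2 * s) - 1) := by
    rw [← Real.rpow_natCast, ← Real.rpow_mul hw.le, ← Real.rpow_add_one hw.ne']
    congr 1
    push_cast
    ring
  calc (w ^ (-s - 1) * (2 * c) * (-s * χ y + deriv χ y / N)) ^ 2 * ‖x‖ ^ 2
      = 4 * c * (-s * χ y + deriv χ y / N) ^ 2 * ((w ^ (-s - 1)) ^ 2 * (c * ‖x‖ ^ 2)) := by ring
    _ ≤ 4 * c * (s + M / N) ^ 2 * ((w ^ (-s - 1)) ^ 2 * w) := by gcongr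
    _ = _ := by rw [hpow]

theorem tendsto_integral_cutoffPower (hc : 0 < c) (hD : 0 < D) {χ : ℝ → ℝ}
    (hχ : ContDiff ℝ ∞ χ) (h0 : ∀ t, 0 ≤ χ t) (h1 : ∀ t, χ t ≤ 1)
    (hone : ∀ t, |t| ≤ 1 → χ t = 1) {s : ℝ} (hs : (finrank ℝ E : ℝ) < 2 * (2 * s + q)) :
    Tendsto (fun n : ℕ => ∫ x : E, cutoffPower χ c D s n x ^ 2 * weight c D x ^ (-q)) atTop
      (𝓝 (∫ x : E, weight c D x ^ (-(2 * s + q)))) := by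
  have hpow : ∀ x : E, (weight c D x ^ (-s)) ^ 2 * weight c D x ^ (-q) =
      weight c D x ^ (-(2 * s + q)) := by
    intro x
    have hw := weight_pos hc hD x
    rw [← Real.rpow_natCast, ← Real.rpow_mul hw.le, ← Real.rpow_add hw]
    congr 1
    push_cast
    ring
  have heq : ∀ (n : ℕ) (x : E), cutoffPower χ c D s n x ^ 2 * weight c D x ^ (-q) =
      χ (Real.log (weight c D x) / n) ^ 2 * weight c D x ^ (-(2 * s + q)) := by
    intro n x
    rw [← hpow, cutoffPower]
    ring
  refine tendsto_integral_of_dominated_convergence (fun x => weight c D x ^ (-(2 * s + q)))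
    (fun n => ?_) (integrable_weight_rpow hc hD hs) (fun n => Eventually.of_forall fun x => ?_)
    (Eventually.of_forall fun x => ?_)
  · exact (((contDiff_cutoffPower hc hD hχ s n).continuous.pow 2).mul
      (contDiff_weight_rpow hc hD (-q) (n := 0)).continuous).aestronglyMeasurable
  · have hw := weight_pos hc hD x
    rw [heq, Real.norm_of_nonneg (by positivity)]
    exact mul_le_of_le_one_left (by positivity) (pow_le_one₀ (h0 _) (h1 _))
  · refine tendsto_const_nhds.congr' ?_
    filter_upwards [eventually_ge_atTop (⌈|Real.log (weight c D x)|⌉₊ + 1)] with n hn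
    have hn' : |Real.log (weight c D x)| ≤ n :=
      (Nat.le_ceil _).trans (by exact_mod_cast (Nat.le_succ _).trans hn)
    have hn0 : (0 : ℝ) < n := by
      exact_mod_cast (Nat.succ_pos _).trans_le hn
    rw [heq, hone _ (by rwa [abs_div, Nat.abs_cast, div_le_one hn0]), one_pow, one_mul]

/-- For the uncut power `w ^ (-s)`, both sides are controlled by the same finite integral of `w ^
(-(2 s + q))`, which is positive and can be divided out. -/
theorem one_le_of_forall_hardy (hc : 0 < c) (hD : 0 < D) {C : ℝ} (hC : 0 ≤ C)
    (h : ∀ g : E → ℝ, ContDiff ℝ ∞ g → HasCompactSupport g →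
      ∫ x, g x ^ 2 * weight c D x ^ (-q) ≤ C * ∫ x, ‖fderiv ℝ g x‖ ^ 2 * weight c D x ^ (1 - q))
    {s : ℝ} (hs0 : 0 ≤ s) (hs : (finrank ℝ E : ℝ) < 2 * (2 * s + q)) :
    1 ≤ C * (4 * c * s ^ 2) := by
  obtain ⟨χ, M, hχ, h0, h1, hone, hzero, hM0, hM⟩ := exists_cutoff
  set J := ∫ x : E, weight c D x ^ (-(2 * s + q)) with hJ
  have hint := integrable_weight_rpow (E := E) hc hD hs
  have hJ0 : 0 < J := by
    refine (integral_pos_iff_support_of_nonneg (fun x => ?_) hint).2 ?_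
    · exact (Real.rpow_pos_of_pos (weight_pos hc hD x) _).le
    · have : Function.support (fun x : E => weight c D x ^ (-(2 * s + q))) = univ := by
        ext x
        simp [(Real.rpow_pos_of_pos (weight_pos hc hD x) _).ne']
      rw [this]
      exact Measure.measure_univ_pos.2 (NeZero.ne _)
  have hlim1 := tendsto_integral_cutoffPower (q := q) hc hD hχ h0 h1 hone hs
  have hlim2 : Tendsto (fun n : ℕ => C * (4 * c * (s + M / n) ^ 2 * J)) atTop
      (𝓝 (C * (4 * c * (s + 0) ^ 2 * J))) :=
    ((((tendsto_const_div_atTop_nhds_zero_nat M).const_add s).pow 2).const_mul _ |>.mul_const J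
      |>.const_mul C)
  have hle : J ≤ C * (4 * c * (s + 0) ^ 2 * J) := by
    refine le_of_tendsto_of_tendsto hlim1 hlim2 ?_
    filter_upwards [eventually_gt_atTop 0] with n hn
    have hn0 : (0 : ℝ) < n := by exact_mod_cast hn
    have hg := contDiff_cutoffPower (E := E) hc hD hχ s n
    have hgs := hasCompactSupport_cutoffPower (E := E) hc hD hzero s hn0
    refine (h _ hg hgs).trans ?_
    gcongr
    rw [hJ, ← integral_const_mul]
    refine integral_mono (integrable_sq_norm_fderiv_mul_weight hc hD _ (hg.of_le (by simp)) hgs)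
      (hint.const_mul _) fun x => ?_
    have hw := weight_pos hc hD x
    calc ‖fderiv ℝ (cutoffPower χ c D s n) x‖ ^ 2 * weight c D x ^ (1 - q)
        ≤ 4 * c * (s + M / n) ^ 2 * weight c D x ^ (-(2 * s) - 1) * weight c D x ^ (1 - q) := by
          gcongr
          exact sq_norm_fderiv_cutoffPower_le hc hD hχ h0 h1 hM hs0 hn0 x
      _ = _ := by
          rw [mul_assoc, ← Real.rpow_add hw]
          congr 2
          ring
  rw [add_zero] at hle
  have : 1 * J ≤ C * (4 * c * s ^ 2) * J := by linarith
  exact le_of_mul_le_mul_right this hJ0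

theorem le_of_forall_hardy (hc : 0 < c) (hD : 0 < D) (hq : 2 * q < finrank ℝ E) {C : ℝ}
    (h : ∀ g : E → ℝ, ContDiff ℝ ∞ g → HasCompactSupport g →
      ∫ x, g x ^ 2 * weight c D x ^ (-q) ≤ C * ∫ x, ‖fderiv ℝ g x‖ ^ 2 * weight c D x ^ (1 - q)) :
    4 / (c * (finrank ℝ E - 2 * q) ^ 2) ≤ C := by
  set k : ℝ := finrank ℝ E - 2 * q with hk
  have hk0 : 0 < k := by linarith
  -- The energy is nonnegative, so `C` may be replaced by `max C 0`; nonnegativity is needed to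
  -- multiply the energy bounds.
  have h' : ∀ g : E → ℝ, ContDiff ℝ ∞ g → HasCompactSupport g →
      ∫ x, g x ^ 2 * weight c D x ^ (-q) ≤
        max C 0 * ∫ x, ‖fderiv ℝ g x‖ ^ 2 * weight c D x ^ (1 - q) := by
    intro g hg hs
    refine (h g hg hs).trans ?_
    gcongr
    · refine integral_nonneg fun x => ?_
      have := weight_pos hc hD x
      exact mul_nonneg (by positivity) (by positivity)
    · exact le_max_left _ _
  -- Integrability of `w ^ (-(2 s + q))` means exactly `s > k / 4`, so the sharp constant is reached
  -- only as a one-sided limit.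
  have hlim : Tendsto (fun s : ℝ => max C 0 * (4 * c * s ^ 2)) (𝓝[>] (k / 4))
      (𝓝 (max C 0 * (4 * c * (k / 4) ^ 2))) :=
    (Continuous.tendsto (by fun_prop) _).mono_left nhdsWithin_le_nhds
  have h1 : 1 ≤ max C 0 * (4 * c * (k / 4) ^ 2) := by
    refine ge_of_tendsto hlim ?_
    filter_upwards [self_mem_nhdsWithin] with s hs
    rw [mem_Ioi] at hs
    exact one_le_of_forall_hardy hc hD (le_max_right _ _) h' (by linarith) (by linarith)
  have h2 : 4 / (c * k ^ 2) ≤ max C 0 := by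
    rw [div_le_iff₀ (by positivity)]
    linarith
  rcases le_max_iff.1 h2 with h3 | h3
  · exact h3
  · have : 0 < 4 / (c * k ^ 2) := by positivity
    linarith

end Optimality

/-! ### Translation to the Barenblatt measures -/

section Barenblatt

/-- As a function of `a`, the right side is a quadratic polynomial minimised at the mean. -/
theorem integral_sq_sub_mean_le {α : Type*} [MeasurableSpace α] {μ : Measure α}
    [IsFiniteMeasure μ] {g : α → ℝ} (h1 : Integrable g μ) (h2 : Integrable (fun x => g x ^ 2) μ)
    (a : ℝ) :
    ∫ x, (g x - (∫ y, g y ∂μ) / μ.real univ) ^ 2 ∂μ ≤ ∫ x, (g x - a) ^ 2 ∂μ := by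
  rcases eq_zero_or_neZero μ with rfl | hμ
  · simp
  have hV : 0 < μ.real univ := measureReal_univ_pos
  set V := μ.real univ with hVdef
  set I := ∫ y, g y ∂μ with hI
  have key : ∀ b : ℝ, ∫ x, (g x - b) ^ 2 ∂μ = (∫ x, g x ^ 2 ∂μ) - 2 * b * I + b ^ 2 * V := by
    intro b
    have : ∀ x, (g x - b) ^ 2 = g x ^ 2 - 2 * b * g x + b ^ 2 := fun x => by ring
    simp_rw [this]
    have h3 : Integrable (fun x => 2 * b * g x) μ := h1.const_mul _
    have h4 : Integrable (fun x => g x ^ 2 - 2 * b * g x) μ := h2.sub h3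
    rw [integral_add h4 (integrable_const _), integral_sub h2 h3, integral_const_mul,
      integral_const, smul_eq_mul]
    ring
  rw [key, key]
  have : (∫ x, g x ^ 2 ∂μ) - 2 * a * I + a ^ 2 * V -
      ((∫ x, g x ^ 2 ∂μ) - 2 * (I / V) * I + (I / V) ^ 2 * V) = (a - I / V) ^ 2 * V := by
    field_simp
    ring
  have : 0 ≤ (a - I / V) ^ 2 * V := by positivity
  linarith

variable {d : ℕ} {m D : ℝ}

theorem barenblatt_eq (d : ℕ) (m D : ℝ) (x : EuclideanSpace ℝ (Fin d)) :
    barenblatt d m D x = weight ((1 - m) / (2 * m)) D x ^ (1 - (1 + 1 / (1 - m))) := by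
  rw [barenblatt, weight, sub_add_cancel_left]

/-- The exponents match because `(2 - m) / (1 - m) = 1 + 1 / (1 - m)`. -/
theorem barenblatt_rpow_eq (hm0 : 0 < m) (hm1 : m < 1) (hD : 0 < D)
    (x : EuclideanSpace ℝ (Fin d)) :
    barenblatt d m D x ^ (2 - m) =
      weight ((1 - m) / (2 * m)) D x ^ (-(1 + 1 / (1 - m))) := by
  have h1 : 0 < 1 - m := by linarith
  have hw := weight_pos (c := (1 - m) / (2 * m)) (by positivity) hD x
  rw [barenblatt_eq, ← Real.rpow_mul hw.le]
  congr 1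
  field_simp
  ring

theorem integral_withDensity_ofReal {α : Type*} [MeasurableSpace α] {μ : Measure α} {w : α → ℝ}
    (hw : Measurable w) (h0 : ∀ x, 0 ≤ w x) (f : α → ℝ) :
    ∫ x, f x ∂(μ.withDensity fun x => ENNReal.ofReal (w x)) = ∫ x, f x * w x ∂μ := by
  rw [integral_withDensity_eq_integral_toReal_smul (by fun_prop)
    (Eventually.of_forall fun x => ENNReal.ofReal_lt_top)]
  congr 1 with x
  rw [ENNReal.toReal_ofReal (h0 x), smul_eq_mul, mul_comm]

theorem integral_muMeasure (hm0 : 0 < m) (hm1 : m < 1) (hD : 0 < D)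
    (f : EuclideanSpace ℝ (Fin d) → ℝ) :
    ∫ x, f x ∂(muMeasure d m D) =
      ∫ x, f x * weight ((1 - m) / (2 * m)) D x ^ (-(1 + 1 / (1 - m))) := by
  have h1 : 0 < 1 - m := by linarith
  have hc : 0 < (1 - m) / (2 * m) := by positivity
  simp_rw [muMeasure, barenblatt_rpow_eq hm0 hm1 hD]
  exact integral_withDensity_ofReal
    (contDiff_weight_rpow hc hD _ (n := 0)).continuous.measurable
    (fun x => (Real.rpow_pos_of_pos (weight_pos hc hD x) _).le) f

theorem energy_eq (hm0 : 0 < m) (hm1 : m < 1) (hD : 0 < D) (g : EuclideanSpace ℝ (Fin d) → ℝ) :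
    energy m D g = ∫ x, ‖fderiv ℝ g x‖ ^ 2 *
      weight ((1 - m) / (2 * m)) D x ^ (1 - (1 + 1 / (1 - m))) := by
  have h1 : 0 < 1 - m := by linarith
  have hc : 0 < (1 - m) / (2 * m) := by positivity
  have hgrad : ∀ x, ‖gradient g x‖ = ‖fderiv ℝ g x‖ := fun x => by
    rw [gradient, LinearIsometryEquiv.norm_map]
  simp_rw [energy, nuMeasure, barenblatt_eq, hgrad]
  exact integral_withDensity_ofReal
    (contDiff_weight_rpow hc hD _ (n := 0)).continuous.measurable
    (fun x => (Real.rpow_pos_of_pos (weight_pos hc hD x) _).le) _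

theorem isFiniteMeasure_muMeasure (hm0 : 0 < m) (hm1 : m < 1) (hD : 0 < D)
    (hq : (d : ℝ) < 2 * (1 + 1 / (1 - m))) : IsFiniteMeasure (muMeasure d m D) := by
  have h1 : 0 < 1 - m := by linarith
  have hc : 0 < (1 - m) / (2 * m) := by positivity
  simp_rw [muMeasure, barenblatt_rpow_eq hm0 hm1 hD]
  refine isFiniteMeasure_withDensity_ofReal (integrable_weight_rpow hc hD ?_).2
  simpa using hq

theorem lt_two_mul_iff_mStar_lt (hd : 5 ≤ d) (hm1 : m < 1) :
    (d : ℝ) < 2 * (1 + 1 / (1 - m)) ↔ mStar d < m := by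
  have hd' : (5 : ℝ) ≤ d := by exact_mod_cast hd
  have h1 : 0 < 1 - m := by linarith
  have h2 : (0 : ℝ) < d - 2 := by linarith
  have e1 : 2 * (1 + 1 / (1 - m)) = (4 - 2 * m) / (1 - m) := by field_simp; ring
  rw [e1, lt_div_iff₀ h1, mStar, div_lt_iff₀ h2]
  constructor <;> intro h <;> linarith

theorem two_mul_lt_iff_lt_mStar (hd : 5 ≤ d) (hm1 : m < 1) :
    2 * (1 + 1 / (1 - m)) < (d : ℝ) ↔ m < mStar d := by
  have hd' : (5 : ℝ) ≤ d := by exact_mod_cast hd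
  have h1 : 0 < 1 - m := by linarith
  have h2 : (0 : ℝ) < d - 2 := by linarith
  have e1 : 2 * (1 + 1 / (1 - m)) = (4 - 2 * m) / (1 - m) := by field_simp; ring
  rw [e1, div_lt_iff₀ h1, mStar, lt_div_iff₀ h2]
  constructor <;> intro h <;> linarith

/-- The key identity is `(d - 2) (m - m_*) = -(1 - m) (d - 2 q)` with `q = 1 + 1 / (1 - m)`. -/
theorem hardy_constant_eq (hd : 5 ≤ d) (hm0 : 0 < m) (hm1 : m < 1) :
    8 * m * (1 - m) / (((d : ℝ) - 2) * (m - mStar d)) ^ 2 =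
      4 / ((1 - m) / (2 * m) * (d - 2 * (1 + 1 / (1 - m))) ^ 2) := by
  have hd' : (5 : ℝ) ≤ d := by exact_mod_cast hd
  have h1 : 0 < 1 - m := by linarith
  have h2 : (0 : ℝ) < d - 2 := by linarith
  have e1 : ((d : ℝ) - 2) * (m - mStar d) = -((1 - m) * (d - 2 * (1 + 1 / (1 - m)))) := by
    unfold mStar
    field_simp
    ring
  rw [e1, neg_sq, mul_pow]
  field_simp
  norm_num

end Barenblatt

end HardyPoincare

end

/-! ### Assembly of the two regimes -/

theorem theoremA1 (d : ℕ) (hd : 1 ≤ d) (m : ℝ) (hm0 : 0 < m) (hm1 : m < 1) :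
    ((d ≤ 4 ∨ (5 ≤ d ∧ HardyPoincare.mStar d < m)) →
      ∃ C : ℝ, 0 < C ∧ ∀ D : ℝ, 0 < D →
        IsFiniteMeasure (HardyPoincare.muMeasure d m D) ∧
        ∀ g : EuclideanSpace ℝ (Fin d) → ℝ, HardyPoincare.IsTestFunction g →
          ∫ x, |g x - HardyPoincare.weightedMean m D g| ^ 2 ∂(HardyPoincare.muMeasure d m D)
            ≤ C * HardyPoincare.energy m D g) ∧
    ((5 ≤ d ∧ m < HardyPoincare.mStar d) →
      ∀ D : ℝ, 0 < D →
        IsLeast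
          {C : ℝ | ∀ g : EuclideanSpace ℝ (Fin d) → ℝ, HardyPoincare.IsTestFunction g →
            ∫ x, g x ^ 2 ∂(HardyPoincare.muMeasure d m D) ≤ C * HardyPoincare.energy m D g}
          (8 * m * (1 - m) / (((d : ℝ) - 2) * (m - HardyPoincare.mStar d)) ^ 2)) := by

  have h1 : 0 < 1 - m := by linarith
  have hc : 0 < (1 - m) / (2 * m) := by positivity
  have hq1 : 1 ≤ 1 + 1 / (1 - m) := by
    have : 0 < 1 / (1 - m) := by positivity
    linarith
  -- Makes the Euclidean space nontrivial, as the radial arguments require.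
  have : Nonempty (Fin d) := ⟨⟨0, hd⟩⟩
  have hdim : Module.finrank ℝ (EuclideanSpace ℝ (Fin d)) = d := by simp
  refine ⟨fun h => ?_, fun ⟨h5, hm⟩ D hD => ⟨fun g hg => ?_, fun C hC => ?_⟩⟩
  · have hq : (d : ℝ) < 2 * (1 + 1 / (1 - m)) := by
      rcases h with h4 | ⟨h5, hm⟩
      · have h4' : (d : ℝ) ≤ 4 := by exact_mod_cast h4
        -- In low dimension there is no threshold: `2 q > 4 ≥ d` for every `m` in `(0, 1)`.
        have : 1 < 1 / (1 - m) := by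
          rw [lt_div_iff₀ h1]
          linarith
        linarith
      · exact (HardyPoincare.lt_two_mul_iff_mStar_lt h5 hm1).2 hm
    obtain ⟨C, hC0, hC⟩ := HardyPoincare.exists_poincare_constant (EuclideanSpace ℝ (Fin d)) hc hq1
      (by rwa [hdim])
    refine ⟨C, hC0, fun D hD => ?_⟩
    have hfin := HardyPoincare.isFiniteMeasure_muMeasure hm0 hm1 hD hq
    refine ⟨hfin, fun g hg => ?_⟩
    obtain ⟨a, ha⟩ := hC D hD g (hg.1.of_le (by simp)) hg.2
    have hgc := hg.1.continuous
    have i1 : Integrable g (HardyPoincare.muMeasure d m D) :=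
      hgc.integrable_of_hasCompactSupport hg.2
    have hsq : HasCompactSupport fun x => g x ^ 2 :=
      hg.2.comp_left (g := fun t : ℝ => t ^ 2) (by simp)
    have i2 : Integrable (fun x => g x ^ 2) (HardyPoincare.muMeasure d m D) :=
      (hgc.pow 2).integrable_of_hasCompactSupport hsq
    simp_rw [sq_abs]
    refine (HardyPoincare.integral_sq_sub_mean_le i1 i2 a).trans ?_
    rw [HardyPoincare.integral_muMeasure hm0 hm1 hD, HardyPoincare.energy_eq hm0 hm1 hD]
    exact ha
  · have h := HardyPoincare.hardy_inequality (q := 1 + 1 / (1 - m)) hc hD (by linarith)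
      (by rw [hdim]; exact (HardyPoincare.two_mul_lt_iff_lt_mStar h5 hm1).2 hm)
      (hg.1.of_le (by simp)) hg.2
    rw [hdim] at h
    rwa [HardyPoincare.integral_muMeasure hm0 hm1 hD, HardyPoincare.energy_eq hm0 hm1 hD,
      HardyPoincare.hardy_constant_eq h5 hm0 hm1]
  · rw [HardyPoincare.hardy_constant_eq h5 hm0 hm1, ← hdim]
    refine HardyPoincare.le_of_forall_hardy hc hD
      (by rw [hdim]; exact (HardyPoincare.two_mul_lt_iff_lt_mStar h5 hm1).2 hm)
      fun g hg hs => ?_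
    have h := hC g ⟨hg, hs⟩
    rwa [HardyPoincare.integral_muMeasure hm0 hm1 hD, HardyPoincare.energy_eq hm0 hm1 hD] at h
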